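/- Let $Z=(Z,d,\mu)$ be a metric measure space, that is, a separable metric space with a Borel regular measure $\mu$ such that $0<\mu(B(z,r))<\infty$ for all $z\in Z$ and $0<r<\infty$. For a real Banach space $(\mathbb V,|\cdot|)$ let $L^\infty(Z;\mathbb V)$ be the space of a.e.-classes of essentially bounded Bochner measurable maps $Z\to\mathbb V$. Let $M^{1,\infty}(Z;\mathbb V)$ be the set of $u\in L^\infty(Z;\mathbb V)$ that have a Hajłasz upper gradient $g\in L^\infty(Z)$, i.e. a measurable $g\colon Z\to[0,\infty]$ such that, for some null set $N$, $|u(x)-u(y)|\le d(x,y)(g(x)+g(y))$ for all $x,y\in Z\setminus N$; put $\|u\|_{M^{1,\infty}}=\|u\|_{L^\infty}+\inf_g\|g\|_{L^\infty}$. A Borel function $\rho\colon Z\to[0,\infty]$ is an $\infty$-weak upper gradient of a map $\widehat u\colon Z\to\mathbb V$ if $|\widehat u(\gamma(a))-\widehat u(\gamma(b))|\le\int_\gamma\rho\,ds$ for every nonconstant rectifiable curve $\gamma\colon[a,b]\to Z$ outside a family $\Gamma$ for which there is a Borel $\rho_0\colon Z\to[0,\infty]$ with $\|\rho_0\|_{L^\infty(Z)}=0$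 and $\int_\gamma\rho_0\,ds=\infty$ for all $\gamma\in\Gamma$. Let $W^{1,\infty}(Z;\mathbb V)$ be the set of $u\in L^\infty(Z;\mathbb V)$ that have a representative $\widehat u$ with an $\infty$-weak upper gradient $\rho\in L^\infty(Z)$; put $\|u\|_{W^{1,\infty}}=\|u\|_{L^\infty}+\inf_\rho\|\rho\|_{L^\infty}$, the infimum being over all such $\rho$ (it does not depend on the choice of such a representative $\widehat u$). Write $M^{1,\infty}(Z)$ and $W^{1,\infty}(Z)$ for $\mathbb V=\mathbb R$. Then: 1. For every Banach space $\mathbb V\neq\{0\}$, $M^{1,\infty}(Z)=W^{1,\infty}(Z)$ if and only if $M^{1,\infty}(Z;\mathbb V)=W^{1,\infty}(Z;\mathbb V)$ (equalities of subsets of $L^\infty$). 2. If $M^{1,\infty}(Z)=W^{1,\infty}(Z)$, then there is a constant $C>0$ such that for every Banach space $\mathbb V$ one has $M^{1,\infty}(Z;\mathbb V)=W^{1,\infty}(Z;\mathbb V)$ and $$\tfrac14\|u\|_{W^{1,\infty}(Z;\mathbb V)}\le\|u\|_{M^{1,\infty}(Z;\mathbb V)}\le C\|u\|_{W^{1,\infty}(Z;\mathbb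 V)}\quad\text{for every }u\in W^{1,\infty}(Z;\mathbb V).$$ -/

import Mathlib

open MeasureTheory Set
open scoped ENNReal

universe u v

namespace MetricSobolev

/-! Curves, curve integrals and negligible curve families. -/

/-- A curve in `Z`: a continuous map `[left, right] → Z`. Only the values of `toFun` on
`[left, right]` matter. -/
structure Curve (Z : Type u) [MetricSpace Z] where
  left : ℝ
  right : ℝ
  left_le_right : left ≤ right
  toFun : ℝ → Z
  continuousOn : ContinuousOn toFun (Icc left right)

namespace Curve

variable {Z : Type u} [MetricSpace Z]

/-- The length: the supremum of `∑ d(γ(tᵢ), γ(tᵢ₊₁))` over finite partitions of the domain. -/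
noncomputable def length (γ : Curve Z) : ℝ≥0∞ :=
  eVariationOn γ.toFun (Icc γ.left γ.right)

def IsRectifiable (γ : Curve Z) : Prop := γ.length < ∞

def IsNonconstant (γ : Curve Z) : Prop :=
  ∃ s ∈ Icc γ.left γ.right, ∃ t ∈ Icc γ.left γ.right, γ.toFun s ≠ γ.toFun t

/-- The unit speed reparametrization `γ̂ : [0, ℓ(γ)] → Z` of a rectifiable curve, characterized by
`γ̂ (ℓ(γ|[left, t])) = γ t`. -/
noncomputable def unitSpeed (γ : Curve Z) : ℝ → Z :=
  naturalParameterization γ.toFun (Icc γ.left γ.right) γ.left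

/-- The curve integral `∫_γ ρ ds = ∫_0^{ℓ(γ)} ρ(γ̂(s)) ds` (used for rectifiable `γ` only). -/
noncomputable def integral (γ : Curve Z) (ρ : Z → ℝ≥0∞) : ℝ≥0∞ :=
  ∫⁻ s in Icc (0 : ℝ) γ.length.toReal, ρ (γ.unitSpeed s)

end Curve

section Spaces

variable {Z : Type u} [MetricSpace Z] [MeasurableSpace Z]
variable {V : Type v} [NormedAddCommGroup V]

/-- A curve family `Γ` is `∞`-negligible: there is a Borel `ρ : Z → [0, ∞]` with
`‖ρ‖_{L^∞} = 0` and `∫_γ ρ ds = ∞` for every rectifiable `γ ∈ Γ`. -/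
def IsInftyNegligible (μ : Measure Z) (Γ : Set (Curve Z)) : Prop :=
  ∃ ρ : Z → ℝ≥0∞, Measurable ρ ∧ essSup ρ μ = 0 ∧
    ∀ γ ∈ Γ, γ.IsRectifiable → γ.integral ρ = ∞

/-- `ρ` is an `∞`-weak upper gradient of the (everywhere defined) map `f`: it is Borel and
`|f(γ(a)) - f(γ(b))| ≤ ∫_γ ρ ds` for `∞`-almost every nonconstant curve `γ : [a, b] → Z`. -/
def IsWeakUpperGradient (μ : Measure Z) (f : Z → V) (ρ : Z → ℝ≥0∞) : Prop :=
  Measurable ρ ∧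
    IsInftyNegligible μ
      {γ : Curve Z | γ.IsNonconstant ∧
        ¬ edist (f (γ.toFun γ.left)) (f (γ.toFun γ.right)) ≤ γ.integral ρ}

/-- The essentially bounded `∞`-weak upper gradients of `f`. -/
def weakUpperGradients (μ : Measure Z) (f : Z → V) : Set (Z → ℝ≥0∞) :=
  {ρ | IsWeakUpperGradient μ f ρ ∧ essSup ρ μ < ∞}

/-- The pointwise defined Newton–Sobolev functions: essentially bounded Bochner measurable maps
that have an essentially bounded `∞`-weak upper gradient. -/
def IsNewtonian (μ : Measure Z) (f : Z → V) : Prop :=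
  MemLp f ∞ μ ∧ (weakUpperGradients μ f).Nonempty

/-- `‖f‖_{L^∞}` plus the infimum of `‖ρ‖_{L^∞}` over the bounded `∞`-weak upper gradients. -/
noncomputable def newtonNorm (μ : Measure Z) (f : Z → V) : ℝ≥0∞ :=
  eLpNorm f ∞ μ + ⨅ ρ ∈ weakUpperGradients μ f, essSup ρ μ

variable (V) in
/-- `W^{1,∞}(Z; V)`, a set of classes in `L^∞(Z; V)`: those with a Newton–Sobolev
representative. -/
def sobolevSpace (μ : Measure Z) : Set (Lp V ∞ μ) :=
  {u | ∃ f : Z → V, IsNewtonian μ f ∧ f =ᵐ[μ] u}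

/-- The norm of `W^{1,∞}(Z; V)`: the Newton–Sobolev norm of a Newton–Sobolev representative. That
norm is the same for all such representatives, and is taken here as their infimum. -/
noncomputable def sobolevNorm {μ : Measure Z} (u : Lp V ∞ μ) : ℝ≥0∞ :=
  ⨅ (f : Z → V) (_ : IsNewtonian μ f ∧ f =ᵐ[μ] u), newtonNorm μ f

/-- The essentially bounded Hajłasz upper gradients of `f`: measurable `g : Z → [0, ∞]` with
`|f(x) - f(y)| ≤ d(x, y) (g(x) + g(y))` for all `x, y` outside a null set. -/
def hajlaszGradients (μ : Measure Z) (f : Z → V) : Set (Z → ℝ≥0∞) :=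
  {g | AEMeasurable g μ ∧
    (∃ N : Set Z, μ N = 0 ∧
      ∀ x ∉ N, ∀ y ∉ N, edist (f x) (f y) ≤ edist x y * (g x + g y)) ∧
    essSup g μ < ∞}

variable (V) in
/-- `M^{1,∞}(Z; V)`, a set of classes in `L^∞(Z; V)`. The set of Hajłasz upper gradients does not
depend on the representative. -/
def hajlaszSpace (μ : Measure Z) : Set (Lp V ∞ μ) :=
  {u | (hajlaszGradients μ u).Nonempty}

/-- The norm of `M^{1,∞}(Z; V)`. -/
noncomputable def hajlaszNorm {μ : Measure Z} (u : Lp V ∞ μ) : ℝ≥0∞ :=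
  eLpNorm u ∞ μ + ⨅ g ∈ hajlaszGradients μ u, essSup g μ

end Spaces

end MetricSobolev

/-! A class lies in `M^{1,∞}` exactly when it is Lipschitz on a set of full measure. Balls have
positive measure, so such a set is dense and the map extends to a Lipschitz representative, whose
Lipschitz constant is an upper gradient. Hence `M ⊆ W` always holds, with control of norms; the
content is the reverse inclusion.

If `W ⊆ M` for real functions, the Lipschitz constants are uniformly bounded on the unit ball of `W`
(`exists_uniform_aelipschitzWith`). For functions `f n` in that ball and `a ∈ ℓ¹`, the sum `∑ a n *
f n` is again in `W`, hence Lipschitz, so Banach–Steinhaus on `ℓ¹` applies to the difference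
quotients; completeness of `W` is never needed.

A `V`-valued map is a.e. separably valued, so countably many functionals of norm at most `1` recover
its Lipschitz constant from the real bound (`aelipschitzWith_of_real_bound`). Conversely, `ℝ` embeds
in `V` as a line. -/

namespace MetricSobolev

open Filter Topology
open scoped NNReal

/-! ### Hajłasz functions as almost everywhere Lipschitz functions. -/

section Lipschitz

variable {Z : Type*} [MetricSpace Z] [MeasurableSpace Z] {μ : Measure Z}
variable {V : Type*} [NormedAddCommGroup V]

/-- `f` is `K`-Lipschitz on a set of full measure. -/
def AELipschitzWith (μ : Measure Z) (K : ℝ≥0) (f : Z → V) : Prop :=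
  ∃ s ∈ ae μ, LipschitzOnWith K f s

theorem AELipschitzWith.congr {K : ℝ≥0} {f g : Z → V} (hf : AELipschitzWith μ K f)
    (h : f =ᵐ[μ] g) : AELipschitzWith μ K g := by
  obtain ⟨s, hs, hL⟩ := hf
  refine ⟨s ∩ {x | f x = g x}, inter_mem hs h, fun x hx y hy => ?_⟩
  rw [← show f x = g x from hx.2, ← show f y = g y from hy.2]
  exact hL hx.1 hy.1

theorem aelipschitzWith_of_mem_hajlaszGradients {f : Z → V} {g : Z → ℝ≥0∞}
    (hg : g ∈ hajlaszGradients μ f) :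
    AELipschitzWith μ (2 * (essSup g μ).toNNReal) f := by
  obtain ⟨-, ⟨N, hN, hfg⟩, hlt⟩ := hg
  refine ⟨Nᶜ ∩ {x | g x ≤ essSup g μ},
    inter_mem (compl_mem_ae_iff.2 hN) (ENNReal.ae_le_essSup g), fun x hx y hy => ?_⟩
  calc edist (f x) (f y) ≤ edist x y * (g x + g y) := hfg x hx.1 y hy.1
    _ ≤ edist x y * (essSup g μ + essSup g μ) := by gcongr; exacts [hx.2, hy.2]
    _ = _ := by
      rw [ENNReal.coe_mul, ENNReal.coe_toNNReal hlt.ne, mul_comm, ← two_mul]; norm_cast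

theorem essSup_const_le {α : Type*} [MeasurableSpace α] {ν : Measure α} (c : ℝ≥0∞) :
    essSup (fun _ : α => c) ν ≤ c :=
  essSup_le_of_ae_le _ (Eventually.of_forall fun _ => le_rfl)

theorem AELipschitzWith.const_mem_hajlaszGradients {K : ℝ≥0} {f : Z → V}
    (hf : AELipschitzWith μ K f) : (fun _ => (K : ℝ≥0∞)) ∈ hajlaszGradients μ f := by
  obtain ⟨s, hs, hL⟩ := hf
  refine ⟨aemeasurable_const, ⟨sᶜ, hs, fun x hx y hy => ?_⟩,
    (essSup_const_le _).trans_lt ENNReal.coe_lt_top⟩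
  rw [notMem_compl_iff] at hx hy
  refine (hL hx hy).trans ?_
  rw [mul_comm]
  gcongr
  exact le_self_add

theorem mem_hajlaszSpace_iff {u : Lp V ∞ μ} :
    u ∈ hajlaszSpace V μ ↔ ∃ K, AELipschitzWith μ K u :=
  ⟨fun ⟨_, hg⟩ => ⟨_, aelipschitzWith_of_mem_hajlaszGradients hg⟩,
    fun ⟨_, hK⟩ => ⟨_, hK.const_mem_hajlaszGradients⟩⟩

theorem AELipschitzWith.hajlaszNorm_le {K : ℝ≥0} {u : Lp V ∞ μ} (hu : AELipschitzWith μ K u) :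
    hajlaszNorm u ≤ eLpNorm u ∞ μ + K := by
  unfold hajlaszNorm
  gcongr
  exact (iInf₂_le _ hu.const_mem_hajlaszGradients).trans (essSup_const_le _)

theorem _root_.LipschitzOnWith.exists_lipschitzWith_of_dense [CompleteSpace V] {X : Type*}
    [PseudoMetricSpace X] {K : ℝ≥0} {f : X → V} {s : Set X} (hs : Dense s)
    (hf : LipschitzOnWith K f s) : ∃ F : X → V, LipschitzWith K F ∧ EqOn F f s := by
  have hu : UniformContinuous (s.domRestrict f) := hf.to_restrict.uniformContinuous
  have hc : Continuous (hs.extend (s.domRestrict f)) :=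
    (uniformContinuous_uniformly_extend (isUniformInducing_val s) hs.denseRange_val hu).continuous
  have he : EqOn (hs.extend (s.domRestrict f)) f s := fun x hx =>
    hs.extend_eq hu.continuous ⟨x, hx⟩
  refine ⟨_, ?_, he⟩
  have h := LipschitzOnWith.closure (s := s) hc.continuousOn (K := K) fun x hx y hy => by
    rw [he hx, he hy]; exact hf hx hy
  rwa [hs.closure_eq, lipschitzOnWith_univ] at h

theorem AELipschitzWith.exists_lipschitzWith [μ.IsOpenPosMeasure] [CompleteSpace V] {K : ℝ≥0}
    {f : Z → V} (hf : AELipschitzWith μ K f) :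
    ∃ F : Z → V, LipschitzWith K F ∧ F =ᵐ[μ] f := by
  obtain ⟨s, hs, hL⟩ := hf
  obtain ⟨F, hF, he⟩ := hL.exists_lipschitzWith_of_dense (Measure.dense_of_ae (p := (· ∈ s)) hs)
  exact ⟨F, hF, mem_of_superset hs he⟩

/-- The full-measure set hidden in the hypothesis meets `D` densely, and continuity carries the
bound to all of `D`. This lets uncountably many functions share one set `D`. -/
theorem AELipschitzWith.lipschitzOnWith [μ.IsOpenPosMeasure] {K : ℝ≥0} {f : Z → V} {D : Set Z}
    (hf : AELipschitzWith μ K f) (hD : D ∈ ae μ) (hc : ContinuousOn f D) :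
    LipschitzOnWith K f D := by
  obtain ⟨s, hs, hL⟩ := hf
  have hd : Dense ((↑) ⁻¹' s : Set D) := by
    rw [Subtype.dense_iff, Subtype.image_preimage_coe]
    intro x _
    exact (Measure.dense_of_ae (p := (· ∈ D ∩ s)) (inter_mem hD hs)) x
  have h := LipschitzOnWith.closure (f := D.domRestrict f) (s := ((↑) ⁻¹' s : Set D)) (K := K)
    hc.domRestrict.continuousOn fun x hx y hy => hL hx hy
  rw [hd.closure_eq, lipschitzOnWith_univ] at h
  exact lipschitzOnWith_iff_restrict.2 h

end Lipschitz

/-! ### Calculus of weak upper gradients, and the inclusion of `M` in `W`. -/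

section UpperGradient

variable {Z : Type*} [MetricSpace Z]

theorem Curve.integral_mono (γ : Curve Z) {ρ ρ' : Z → ℝ≥0∞} (h : ρ ≤ ρ') :
    γ.integral ρ ≤ γ.integral ρ' :=
  lintegral_mono fun _ => h _

theorem Curve.integral_const (γ : Curve Z) (hγ : γ.IsRectifiable) (c : ℝ≥0∞) :
    γ.integral (fun _ => c) = c * γ.length := by
  simp [Curve.integral, ENNReal.ofReal_toReal (ne_of_lt hγ)]

theorem Curve.mul_integral_le (γ : Curve Z) (c : ℝ≥0∞) (ρ : Z → ℝ≥0∞) :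
    c * γ.integral ρ ≤ γ.integral fun z => c * ρ z :=
  lintegral_const_mul_le _ _

/-- Superadditivity of the lower integral suffices, so no measurability of `ρ n` along `γ` is
required. -/
theorem Curve.tsum_integral_le (γ : Curve Z) (ρ : ℕ → Z → ℝ≥0∞) :
    ∑' n, γ.integral (ρ n) ≤ γ.integral fun z => ∑' n, ρ n z := by
  rw [ENNReal.tsum_eq_iSup_sum]
  refine iSup_le fun s => ?_
  have h : ∑ n ∈ s, γ.integral (ρ n) ≤ γ.integral fun z => ∑ n ∈ s, ρ n z := by
    classical
    induction s using Finset.induction_on with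
    | empty => simp
    | insert n s hn ih =>
      simp only [Finset.sum_insert hn]
      exact (add_le_add_right ih _).trans (le_lintegral_add _ _)
  exact h.trans (γ.integral_mono fun z => ENNReal.sum_le_tsum s)

theorem Curve.edist_le_length (γ : Curve Z) :
    edist (γ.toFun γ.left) (γ.toFun γ.right) ≤ γ.length :=
  eVariationOn.edist_le _ (left_mem_Icc.2 γ.left_le_right) (right_mem_Icc.2 γ.left_le_right)

variable [MeasurableSpace Z] {μ : Measure Z}
variable {V : Type*} [NormedAddCommGroup V] {W : Type*} [NormedAddCommGroup W]

theorem _root_.LipschitzWith.isWeakUpperGradient {K : ℝ≥0} {f : Z → V} (hf : LipschitzWith K f) :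
    IsWeakUpperGradient μ f fun _ => (K : ℝ≥0∞) := by
  refine ⟨measurable_const, 0, measurable_const,
    ENNReal.essSup_eq_zero_iff.2 (ae_eq_refl _), fun γ hγ hr => ?_⟩
  refine absurd ?_ hγ.2
  rw [γ.integral_const hr]
  exact (hf _ _).trans (by gcongr; exact γ.edist_le_length)

theorem IsWeakUpperGradient.lipschitzWith_comp {K : ℝ≥0} {f : Z → V} {ρ : Z → ℝ≥0∞} {φ : V → W}
    (h : IsWeakUpperGradient μ f ρ) (hφ : LipschitzWith K φ) :
    IsWeakUpperGradient μ (φ ∘ f) fun z => K * ρ z := by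
  obtain ⟨hρ, ρ₀, hρ₀, h0, hΓ⟩ := h
  refine ⟨hρ.const_mul _, ρ₀, hρ₀, h0, fun γ hγ hr => hΓ γ ⟨hγ.1, fun hle => hγ.2 ?_⟩ hr⟩
  calc edist (φ (f (γ.toFun γ.left))) (φ (f (γ.toFun γ.right)))
      ≤ K * edist (f (γ.toFun γ.left)) (f (γ.toFun γ.right)) := hφ _ _
    _ ≤ K * γ.integral ρ := by gcongr
    _ ≤ _ := γ.mul_integral_le _ _

theorem essSup_tsum_le {α : Type*} [MeasurableSpace α] {ν : Measure α} (ρ : ℕ → α → ℝ≥0∞) :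
    essSup (fun z => ∑' n, ρ n z) ν ≤ ∑' n, essSup (ρ n) ν := by
  refine essSup_le_of_ae_le _ ?_
  filter_upwards [ae_all_iff.2 fun n => ENNReal.ae_le_essSup (μ := ν) (ρ n)] with z hz
  exact ENNReal.tsum_le_tsum hz

/-- If the inequality fails on a curve for the sum, it fails there for some `n`; the sum of the
functions `ρ₀ n` therefore witnesses negligibility. -/
theorem IsWeakUpperGradient.tsum {f : ℕ → Z → V} {ρ : ℕ → Z → ℝ≥0∞}
    (h : ∀ n, IsWeakUpperGradient μ (f n) (ρ n)) (hf : ∀ z, Summable fun n => f n z) :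
    IsWeakUpperGradient μ (fun z => ∑' n, f n z) fun z => ∑' n, ρ n z := by
  choose hρ ρ₀ hρ₀ h0 hΓ using h
  refine ⟨Measurable.tsum hρ, fun z => ∑' n, ρ₀ n z, Measurable.tsum hρ₀, ?_, ?_⟩
  · exact le_antisymm ((essSup_tsum_le _).trans (by simp [h0])) bot_le
  · rintro γ ⟨hγ, hn⟩ hr
    obtain ⟨n, hn⟩ : ∃ n, ¬ edist (f n (γ.toFun γ.left)) (f n (γ.toFun γ.right)) ≤
        γ.integral (ρ n) := by
      by_contra! hle
      refine hn ?_
      calc edist (∑' n, f n (γ.toFun γ.left)) (∑' n, f n (γ.toFun γ.right))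
          = ‖∑' n, (f n (γ.toFun γ.left) - f n (γ.toFun γ.right))‖ₑ := by
            rw [(hf _).tsum_sub (hf _), edist_eq_enorm_sub]
        _ ≤ ∑' n, ‖f n (γ.toFun γ.left) - f n (γ.toFun γ.right)‖ₑ := enorm_tsum_le_tsum_enorm
        _ ≤ ∑' n, γ.integral (ρ n) := ENNReal.tsum_le_tsum fun n => by
            rw [← edist_eq_enorm_sub]; exact hle n
        _ ≤ _ := γ.tsum_integral_le ρ
    refine top_le_iff.1 ?_
    rw [← hΓ n γ ⟨hγ, hn⟩ hr]
    exact γ.integral_mono fun z => ENNReal.le_tsum n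

theorem IsNewtonian.lipschitzWith_comp {K : ℝ≥0} {f : Z → V} {φ : V → W}
    (h : IsNewtonian μ f) (hφ : LipschitzWith K φ) (h0 : φ 0 = 0) : IsNewtonian μ (φ ∘ f) := by
  obtain ⟨hf, ρ, hρ, hlt⟩ := h
  refine ⟨hφ.comp_memLp h0 hf, _, hρ.lipschitzWith_comp hφ, ?_⟩
  rw [ENNReal.essSup_const_mul]
  exact ENNReal.mul_lt_top ENNReal.coe_lt_top hlt

theorem AELipschitzWith.exists_isNewtonian [μ.IsOpenPosMeasure] [CompleteSpace V] {K : ℝ≥0}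
    {u : Lp V ∞ μ} (hu : AELipschitzWith μ K u) :
    ∃ f : Z → V, IsNewtonian μ f ∧ f =ᵐ[μ] u ∧ newtonNorm μ f ≤ eLpNorm u ∞ μ + K := by
  obtain ⟨F, hF, hFu⟩ := hu.exists_lipschitzWith
  have hmem : (fun _ => (K : ℝ≥0∞)) ∈ weakUpperGradients μ F :=
    ⟨hF.isWeakUpperGradient, (essSup_const_le _).trans_lt ENNReal.coe_lt_top⟩
  refine ⟨F, ⟨(memLp_congr_ae hFu).2 (Lp.memLp u), _, hmem⟩, hFu, ?_⟩
  rw [← eLpNorm_congr_ae hFu]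
  unfold newtonNorm
  gcongr
  exact (iInf₂_le _ hmem).trans (essSup_const_le _)

theorem hajlaszSpace_subset_sobolevSpace [μ.IsOpenPosMeasure] [CompleteSpace V] :
    hajlaszSpace V μ ⊆ sobolevSpace V μ := by
  intro u hu
  obtain ⟨K, hK⟩ := mem_hajlaszSpace_iff.1 hu
  obtain ⟨f, hf, hfu, -⟩ := hK.exists_isNewtonian
  exact ⟨f, hf, hfu⟩

theorem sobolevNorm_le_two_mul_hajlaszNorm [μ.IsOpenPosMeasure] [CompleteSpace V]
    (u : Lp V ∞ μ) : sobolevNorm u ≤ 2 * hajlaszNorm u := by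
  unfold hajlaszNorm
  rw [ENNReal.add_iInf, ENNReal.mul_iInf_of_ne (by simp) (by simp)]
  refine le_iInf fun g => ?_
  by_cases hg : g ∈ hajlaszGradients μ u
  swap
  · simp [hg]
  obtain ⟨f, hf, hfu, hle⟩ :=
    (aelipschitzWith_of_mem_hajlaszGradients hg).exists_isNewtonian
  refine (iInf₂_le f ⟨hf, hfu⟩).trans (hle.trans ?_)
  rw [ENNReal.coe_mul, ENNReal.coe_toNNReal hg.2.2.ne, mul_add]
  simp only [hg, iInf_pos]
  gcongr
  · rw [two_mul]; exact le_self_add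
  · simp

end UpperGradient

/-! ### Uniform Lipschitz bound for real functions via Banach–Steinhaus on `ℓ¹`. -/

section UniformBound

theorem summable_norm_lp_one (a : lp (fun _ : ℕ => ℝ) 1) : Summable fun n => ‖a n‖ := by
  simpa using (lp.memℓp a).summable (by simp)

theorem norm_lp_one (a : lp (fun _ : ℕ => ℝ) 1) : ‖a‖ = ∑' n, ‖a n‖ := by
  simp [lp.norm_eq_tsum_rpow (p := 1) (by simp) a]

theorem summable_norm_lp_one_mul (a : lp (fun _ : ℕ => ℝ) 1) {b : ℕ → ℝ} (hb : ∀ n, ‖b n‖ ≤ 1) :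
    Summable fun n => ‖a n * b n‖ :=
  (summable_norm_lp_one a).of_nonneg_of_le (fun _ => norm_nonneg _) fun n => by
    rw [norm_mul]; exact mul_le_of_le_one_right (norm_nonneg _) (hb n)

/-- The pairing of `ℓ¹` with a sequence bounded by `1`. -/
noncomputable def lpOnePairing (b : ℕ → ℝ) (hb : ∀ n, ‖b n‖ ≤ 1) :
    lp (fun _ : ℕ => ℝ) 1 →L[ℝ] ℝ :=
  LinearMap.mkContinuous
    { toFun := fun a => ∑' n, a n * b n
      map_add' := fun a a' => by
        rw [← (summable_norm_lp_one_mul a hb).of_norm.tsum_add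
          (summable_norm_lp_one_mul a' hb).of_norm]
        simp [add_mul]
      map_smul' := fun c a => by
        simp [mul_assoc, tsum_mul_left] } 1 fun a => by
    rw [one_mul, norm_lp_one]
    refine (norm_tsum_le_tsum_norm (summable_norm_lp_one_mul a hb)).trans
      ((summable_norm_lp_one_mul a hb).tsum_le_tsum (fun n => ?_) (summable_norm_lp_one a))
    rw [norm_mul]; exact mul_le_of_le_one_right (norm_nonneg _) (hb n)

theorem lpOnePairing_apply (b : ℕ → ℝ) (hb : ∀ n, ‖b n‖ ≤ 1) (a : lp (fun _ : ℕ => ℝ) 1) :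
    lpOnePairing b hb a = ∑' n, a n * b n := rfl

theorem lpOnePairing_single (b : ℕ → ℝ) (hb : ∀ n, ‖b n‖ ≤ 1) (n : ℕ) :
    lpOnePairing b hb (lp.single 1 n 1) = b n := by
  rw [lpOnePairing_apply, tsum_eq_single n fun m hm => by simp [hm]]
  simp

variable {Z : Type*} [MetricSpace Z] [MeasurableSpace Z] {μ : Measure Z}

theorem IsNewtonian.exists_aelipschitzWith {V : Type*} [NormedAddCommGroup V]
    (h : sobolevSpace V μ ⊆ hajlaszSpace V μ) {f : Z → V} (hf : IsNewtonian μ f) :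
    ∃ K, AELipschitzWith μ K f := by
  obtain ⟨K, hK⟩ := mem_hajlaszSpace_iff.1 (h ⟨f, hf, hf.1.coeFn_toLp.symm⟩)
  exact ⟨K, hK.congr hf.1.coeFn_toLp⟩

/-- If every real Sobolev function is Lipschitz almost everywhere, then the Lipschitz constants
are bounded on the unit ball of the Sobolev space. -/
theorem exists_uniform_aelipschitzWith [μ.IsOpenPosMeasure]
    (h : sobolevSpace ℝ μ ⊆ hajlaszSpace ℝ μ) :
    ∃ C : ℝ≥0, ∀ f : Z → ℝ, AEStronglyMeasurable f μ → (∀ z, ‖f z‖ ≤ 1) →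
      ∀ ρ, IsWeakUpperGradient μ f ρ → essSup ρ μ ≤ 1 → AELipschitzWith μ C f := by
  by_contra! H
  choose f hfm hf1 ρ hρ hρ1 hnot using fun n : ℕ => H n
  have hN : ∀ n, IsNewtonian μ (f n) := fun n =>
    ⟨memLp_top_of_bound (hfm n) 1 (Eventually.of_forall (hf1 n)), ρ n, hρ n,
      (hρ1 n).trans_lt ENNReal.one_lt_top⟩
  choose K s hs hK using fun n => (hN n).exists_aelipschitzWith h
  have hD : (⋂ n, s n) ∈ ae μ := countable_iInter_mem.2 hs
  set D := ⋂ n, s n with hDdef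
  have hLip : ∀ a : lp (fun _ : ℕ => ℝ) 1, ∃ L : ℝ≥0,
      LipschitzOnWith L (fun z => ∑' n, a n * f n z) D := by
    intro a
    have hsum := fun z => (summable_norm_lp_one_mul a fun n => hf1 n z)
    have hle : ∀ n z, ‖a n * f n z‖ ≤ ‖a n‖ := fun n z => by
      rw [norm_mul]; exact mul_le_of_le_one_right (norm_nonneg _) (hf1 n z)
    have hNa : IsNewtonian μ fun z => ∑' n, a n * f n z := by
      refine ⟨memLp_top_of_bound (AEStronglyMeasurable.tsum fun n => (hfm n).const_mul _)
        (∑' n, ‖a n‖) (Eventually.of_forall fun z => ?_), _,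
        IsWeakUpperGradient.tsum (f := fun n z => a n * f n z)
          (fun n => (hρ n).lipschitzWith_comp (lipschitzWith_smul (a n)))
          (fun z => (hsum z).of_norm), ?_⟩
      · exact (norm_tsum_le_tsum_norm (hsum z)).trans
          ((hsum z).tsum_le_tsum (fun n => hle n z) (summable_norm_lp_one a))
      · refine (essSup_tsum_le _).trans_lt ?_
        calc ∑' n, essSup (fun z => (‖a n‖₊ : ℝ≥0∞) * ρ n z) μ
            ≤ ∑' n, (‖a n‖₊ : ℝ≥0∞) := ENNReal.tsum_le_tsum fun n => by
              rw [ENNReal.essSup_const_mul]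
              exact mul_le_of_le_one_right' (hρ1 n)
          _ < ∞ := lt_top_iff_ne_top.2 (ENNReal.tsum_coe_ne_top_iff_summable.2
              (by simpa [← NNReal.summable_coe] using summable_norm_lp_one a))
    obtain ⟨L, hL⟩ := hNa.exists_aelipschitzWith h
    refine ⟨L, hL.lipschitzOnWith hD (continuousOn_tsum (fun n => ?_) (summable_norm_lp_one a)
      fun n z _ => hle n z)⟩
    -- Each `f n` is Lipschitz on `D`, with no uniformity in `n`; uniform convergence makes the sum
    -- continuous on `D`.
    exact continuousOn_const.mul ((hK n).continuousOn.mono (iInter_subset _ n))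
  -- The functionals are difference quotients indexed by pairs in `D`; on the diagonal `0⁻¹ = 0`
  -- makes them vanish.
  obtain ⟨C, hC⟩ := banach_steinhaus (ι := D × D) (g := fun p => (dist p.1 p.2)⁻¹ •
      (lpOnePairing (fun n => f n p.1) (fun n => hf1 n p.1) -
        lpOnePairing (fun n => f n p.2) (fun n => hf1 n p.2))) fun a => by
    obtain ⟨L, hL⟩ := hLip a
    refine ⟨L, fun ⟨x, y⟩ => ?_⟩
    have hxy := hL.dist_le_mul x x.2 y y.2
    rw [Real.dist_eq] at hxy
    rw [smul_apply, sub_apply, lpOnePairing_apply,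
      lpOnePairing_apply, norm_smul, norm_inv, Real.norm_of_nonneg dist_nonneg, Real.norm_eq_abs]
    exact inv_mul_le_of_le_mul₀ dist_nonneg L.2 (by rw [mul_comm]; exact hxy)
  obtain ⟨n, hn⟩ := exists_nat_ge C
  refine hnot n ⟨D, hD, LipschitzOnWith.of_dist_le_mul fun x hx y hy => ?_⟩
  rcases eq_or_ne x y with rfl | hxy
  · simp
  -- Testing on the `n`-th unit vector gives back `f n`, now with constant `C ≤ n`, against its
  -- choice.
  have h1 := ContinuousLinearMap.le_of_opNorm_le _ (hC (⟨x, hx⟩, ⟨y, hy⟩)) (lp.single 1 n 1)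
  rw [smul_apply, sub_apply, lpOnePairing_single,
    lpOnePairing_single, norm_smul, norm_inv, Real.norm_of_nonneg dist_nonneg,
    lp.norm_single (by simp), norm_one, mul_one, ← dist_eq_norm,
    inv_mul_le_iff₀ (dist_pos.2 (by simpa using hxy)), mul_comm] at h1
  exact h1.trans (mul_le_mul_of_nonneg_right (by simpa using hn) dist_nonneg)

end UniformBound

/-! ### Transfer between real-valued and Banach-valued maps. -/

section VectorValued

variable {Z : Type*} [MetricSpace Z] [MeasurableSpace Z] {μ : Measure Z}
variable {V : Type*} [NormedAddCommGroup V] [NormedSpace ℝ V]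

/-- A separable set is normed by countably many functionals of norm at most `1`. -/
theorem exists_countable_norming {t : Set V} (ht : TopologicalSpace.IsSeparable t) :
    ∃ S : Set (StrongDual ℝ V), S.Countable ∧ (∀ φ ∈ S, ‖φ‖ ≤ 1) ∧
      ∀ v ∈ t, ∀ c : ℝ, (∀ φ ∈ S, φ v ≤ c) → ‖v‖ ≤ c := by
  obtain ⟨d, -, hd, htd⟩ := ht.exists_countable_dense_subset
  choose φ hφ1 hφ using fun x : V => exists_dual_vector'' ℝ x
  refine ⟨φ '' d, hd.image φ, ?_, fun v hv c hc => le_of_forall_pos_le_add fun ε hε => ?_⟩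
  · rintro _ ⟨x, -, rfl⟩; exact hφ1 x
  obtain ⟨x, hx, hxv⟩ := Metric.mem_closure_iff.1 (htd hv) (ε / 2) (half_pos hε)
  have h1 : ‖x‖ = φ x v - φ x (v - x) := by
    have := hφ x
    simp only [RCLike.ofReal_real_eq_id, id_eq] at this
    rw [map_sub, this]; ring
  have h2 := (φ x).le_of_opNorm_le (hφ1 x) (v - x)
  rw [Real.norm_eq_abs, one_mul, ← dist_eq_norm] at h2
  have h3 : ‖v‖ ≤ ‖x‖ + dist v x := by
    rw [dist_eq_norm]; exact norm_le_insert' v x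
  linarith [hc _ ⟨x, hx, rfl⟩, neg_abs_le (φ x (v - x))]

theorem aelipschitzWith_of_real_bound {C : ℝ≥0}
    (hC : ∀ f : Z → ℝ, AEStronglyMeasurable f μ → (∀ z, ‖f z‖ ≤ 1) →
      ∀ ρ, IsWeakUpperGradient μ f ρ → essSup ρ μ ≤ 1 → AELipschitzWith μ C f)
    {f : Z → V} (hf : AEStronglyMeasurable f μ) {ρ : Z → ℝ≥0∞} (hρ : IsWeakUpperGradient μ f ρ)
    {K : ℝ≥0} (hK : 0 < K) (hfK : eLpNorm f ∞ μ ≤ K) (hρK : essSup ρ μ ≤ K) :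
    AELipschitzWith μ (C * K) f := by
  obtain ⟨t, ht, hft⟩ := hf.isSeparable_ae_range
  -- The functionals have to norm the differences `f x - f y`, so they are chosen for `t - t`.
  obtain ⟨S, hS, hS1, hnorm⟩ := exists_countable_norming
    ((ht.prod ht).image (f := fun p : V × V => p.1 - p.2) (by fun_prop))
  -- Scaling by `K⁻¹` normalizes both the function and its upper gradient. Clamping makes the bound
  -- by `1` hold everywhere, as `hC` demands, and changes nothing where `‖f z‖ ≤ K`.
  have hψ : ∀ φ ∈ S, LipschitzWith K⁻¹ fun v : V => max (-1) (min 1 ((K : ℝ)⁻¹ * φ v)) := by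
    intro φ hφ
    refine LipschitzWith.const_max (LipschitzWith.const_min
      (LipschitzWith.of_dist_le_mul fun v w => ?_) _) _
    rw [Real.dist_eq, ← mul_sub, ← map_sub, abs_mul, abs_of_nonneg (by positivity), dist_eq_norm,
      NNReal.coe_inv]
    gcongr
    simpa using φ.le_of_opNorm_le (hS1 φ hφ) (v - w)
  have hlip : ∀ φ ∈ S, ∃ s ∈ ae μ,
      LipschitzOnWith C (fun z => max (-1) (min 1 ((K : ℝ)⁻¹ * φ (f z)))) s := by
    intro φ hφ
    refine hC _ ((hψ φ hφ).continuous.comp_aestronglyMeasurable hf) (fun z => ?_) _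
      (hρ.lipschitzWith_comp (hψ φ hφ)) ?_
    · rw [Real.norm_eq_abs, abs_le]
      exact ⟨le_max_left _ _, max_le (by norm_num) (min_le_left _ _)⟩
    · rw [ENNReal.essSup_const_mul, ENNReal.coe_inv hK.ne']
      refine (mul_le_mul_right hρK _).trans ?_
      exact (ENNReal.inv_mul_cancel (by simpa using hK.ne') ENNReal.coe_ne_top).le
  choose! s hs hsL using hlip
  have hbd : ∀ᵐ z ∂μ, ‖f z‖ ≤ K := by
    rw [eLpNorm_exponent_top] at hfK
    filter_upwards [ae_le_eLpNormEssSup (f := f) (μ := μ)] with z hz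
    exact_mod_cast enorm_le_coe.1 (hz.trans hfK)
  refine ⟨(⋂ φ ∈ S, s φ) ∩ ({z | f z ∈ t} ∩ {z | ‖f z‖ ≤ K}),
    inter_mem ((countable_bInter_mem hS).2 hs) (inter_mem hft hbd),
    LipschitzOnWith.of_dist_le_mul ?_⟩
  rintro x ⟨hx, hxt, hxK⟩ y ⟨hy, hyt, hyK⟩
  rw [dist_eq_norm]
  refine hnorm _ ⟨(f x, f y), ⟨hxt, hyt⟩, rfl⟩ _ fun φ hφ => ?_
  have hK' : (0 : ℝ) < K := hK
  have hclamp : ∀ z, ‖f z‖ ≤ K → max (-1) (min 1 ((K : ℝ)⁻¹ * φ (f z))) = (K : ℝ)⁻¹ * φ (f z) := by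
    intro z hz
    have h1 : |φ (f z)| ≤ K := by
      simpa using (φ.le_of_opNorm_le (hS1 φ hφ) (f z)).trans (by simpa using hz)
    have h2 : |(K : ℝ)⁻¹ * φ (f z)| ≤ 1 := by
      rw [abs_mul, abs_of_nonneg (by positivity), inv_mul_le_iff₀ hK', mul_one]
      exact h1
    rw [min_eq_right (abs_le.1 h2).2, max_eq_right (abs_le.1 h2).1]
  have h := (hsL φ hφ).dist_le_mul x (mem_iInter₂.1 hx φ hφ) y (mem_iInter₂.1 hy φ hφ)
  rw [hclamp x hxK, hclamp y hyK, Real.dist_eq, ← mul_sub, ← map_sub, abs_mul,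
    abs_of_nonneg (by positivity), inv_mul_le_iff₀ hK'] at h
  rw [NNReal.coe_mul]
  calc φ (f x - f y) ≤ |φ (f x - f y)| := le_abs_self _
    _ ≤ K * (C * dist x y) := h
    _ = C * K * dist x y := by ring

theorem hajlaszNorm_le_of_real_bound {C : ℝ≥0}
    (hC : ∀ f : Z → ℝ, AEStronglyMeasurable f μ → (∀ z, ‖f z‖ ≤ 1) →
      ∀ ρ, IsWeakUpperGradient μ f ρ → essSup ρ μ ≤ 1 → AELipschitzWith μ C f)
    (u : Lp V ∞ μ) : hajlaszNorm u ≤ ((C + 1 : ℝ≥0) : ℝ≥0∞) * sobolevNorm u := by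
  have hC0 : ((C + 1 : ℝ≥0) : ℝ≥0∞) ≠ 0 := by simp
  rw [mul_comm, ← ENNReal.div_le_iff_le_mul (Or.inl hC0) (Or.inl ENNReal.coe_ne_top)]
  refine le_iInf₂ fun f hf => ?_
  unfold newtonNorm
  rw [ENNReal.add_iInf]
  refine le_iInf fun ρ => ?_
  by_cases hρ : ρ ∈ weakUpperGradients μ f
  swap
  · simp [hρ]
  simp only [hρ, iInf_pos]
  rw [ENNReal.div_le_iff_le_mul (Or.inl hC0) (Or.inl ENNReal.coe_ne_top), mul_comm]
  set A := eLpNorm f ∞ μ + essSup ρ μ with hA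
  have hAt : A ≠ ∞ := ENNReal.add_ne_top.2 ⟨hf.1.1.2.ne, hρ.2.ne⟩
  refine ENNReal.le_of_forall_pos_le_add fun ε hε _ => ?_
  -- The scale must be positive even when `A = 0`; this increment costs exactly `ε` after
  -- multiplication by `C + 1`.
  have hδ : 0 < ε / (C + 1) := by positivity
  have hle : A ≤ (A.toNNReal + ε / (C + 1) : ℝ≥0) := by
    rw [ENNReal.coe_add, ENNReal.coe_toNNReal hAt]; exact le_self_add
  have hu : AELipschitzWith μ (C * (A.toNNReal + ε / (C + 1))) u :=
    (aelipschitzWith_of_real_bound hC hf.1.1.1 hρ.1 (K := A.toNNReal + ε / (C + 1))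
      (by positivity) (le_self_add.trans hle) (le_add_self.trans hle)).congr hf.2
  refine hu.hajlaszNorm_le.trans ?_
  rw [← eLpNorm_congr_ae hf.2]
  calc eLpNorm f ∞ μ + (C * (A.toNNReal + ε / (C + 1)) : ℝ≥0)
      ≤ A.toNNReal + (C * (A.toNNReal + ε / (C + 1)) : ℝ≥0) := by
        rw [ENNReal.coe_toNNReal hAt]; gcongr; exact le_self_add
    _ = ((A.toNNReal + C * (A.toNNReal + ε / (C + 1)) : ℝ≥0) : ℝ≥0∞) := by norm_cast
    _ ≤ (((C + 1) * A.toNNReal + ε : ℝ≥0) : ℝ≥0∞) := by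
        rw [ENNReal.coe_le_coe]
        have : (C + 1) * (ε / (C + 1)) = ε := mul_div_cancel₀ _ (by positivity)
        calc A.toNNReal + C * (A.toNNReal + ε / (C + 1))
            ≤ A.toNNReal + C * (A.toNNReal + ε / (C + 1)) + ε / (C + 1) := le_self_add
          _ = (C + 1) * A.toNNReal + (C + 1) * (ε / (C + 1)) := by ring
          _ = _ := by rw [this]
    _ = _ := by rw [ENNReal.coe_add, ENNReal.coe_mul, ENNReal.coe_toNNReal hAt]

theorem sobolevSpace_subset_of_real_bound {C : ℝ≥0}
    (hC : ∀ f : Z → ℝ, AEStronglyMeasurable f μ → (∀ z, ‖f z‖ ≤ 1) →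
      ∀ ρ, IsWeakUpperGradient μ f ρ → essSup ρ μ ≤ 1 → AELipschitzWith μ C f) :
    sobolevSpace V μ ⊆ hajlaszSpace V μ := by
  rintro u ⟨f, ⟨hf, ρ, hρ, hρt⟩, hfu⟩
  have hA : eLpNorm f ∞ μ + essSup ρ μ ≠ ∞ := ENNReal.add_ne_top.2 ⟨hf.2.ne, hρt.ne⟩
  have hle : eLpNorm f ∞ μ + essSup ρ μ ≤
      ((eLpNorm f ∞ μ + essSup ρ μ).toNNReal + 1 : ℝ≥0) := by
    rw [ENNReal.coe_add, ENNReal.coe_toNNReal hA]; exact le_self_add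
  exact mem_hajlaszSpace_iff.2 ⟨_, (aelipschitzWith_of_real_bound hC hf.1 hρ (by positivity)
    (le_self_add.trans hle) (le_add_self.trans hle)).congr hfu⟩

/-- The map `a ↦ a • v` with `v ≠ 0` multiplies distances by `‖v‖`, so Lipschitz bounds pass in both
directions. -/
theorem sobolevSpace_real_subset [Nontrivial V] (h : sobolevSpace V μ ⊆ hajlaszSpace V μ) :
    sobolevSpace ℝ μ ⊆ hajlaszSpace ℝ μ := by
  rintro u ⟨f, hf, hfu⟩
  obtain ⟨v, hv⟩ := exists_ne (0 : V)
  have hL : LipschitzWith ‖v‖₊ fun a : ℝ => a • v :=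
    LipschitzWith.of_dist_le_mul fun a b => by
      rw [dist_eq_norm, ← sub_smul, norm_smul, mul_comm, dist_eq_norm, coe_nnnorm]
  obtain ⟨K, s, hs, hK⟩ := (hf.lipschitzWith_comp hL (zero_smul ℝ v)).exists_aelipschitzWith h
  refine mem_hajlaszSpace_iff.2 ⟨K / ‖v‖₊, AELipschitzWith.congr
    ⟨s, hs, LipschitzOnWith.of_dist_le_mul fun x hx y hy => ?_⟩ hfu⟩
  have h1 := hK.dist_le_mul x hx y hy
  rw [Function.comp_apply, Function.comp_apply, dist_eq_norm, ← sub_smul, norm_smul,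
    ← dist_eq_norm] at h1
  rw [NNReal.coe_div, coe_nnnorm, div_mul_eq_mul_div, le_div_iff₀ (norm_pos_iff.2 hv)]
  exact h1

end VectorValued

end MetricSobolev

theorem mainTheorem10 {Z : Type u} [MetricSpace Z] [TopologicalSpace.SeparableSpace Z]
    [MeasurableSpace Z] [BorelSpace Z] (μ : Measure Z)
    (hμ : ∀ (z : Z) (r : ℝ), 0 < r → 0 < μ (Metric.ball z r) ∧ μ (Metric.ball z r) < ∞) :
    (∀ (V : Type v) [NormedAddCommGroup V] [NormedSpace ℝ V] [CompleteSpace V] [Nontrivial V],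
      MetricSobolev.hajlaszSpace ℝ μ = MetricSobolev.sobolevSpace ℝ μ ↔
        MetricSobolev.hajlaszSpace V μ = MetricSobolev.sobolevSpace V μ) ∧
    (MetricSobolev.hajlaszSpace ℝ μ = MetricSobolev.sobolevSpace ℝ μ →
      ∃ C : NNReal, 0 < C ∧
        ∀ (V : Type v) [NormedAddCommGroup V] [NormedSpace ℝ V] [CompleteSpace V],
          MetricSobolev.hajlaszSpace V μ = MetricSobolev.sobolevSpace V μ ∧
          ∀ u ∈ MetricSobolev.sobolevSpace V μ,
            (1 / 4 : ℝ≥0∞) * MetricSobolev.sobolevNorm u ≤ MetricSobolev.hajlaszNorm u ∧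
            MetricSobolev.hajlaszNorm u ≤ (C : ℝ≥0∞) * MetricSobolev.sobolevNorm u) := by
  open MetricSobolev in
  have : μ.IsOpenPosMeasure := ⟨fun U hU ⟨z, hz⟩ => by
    obtain ⟨r, hr, hrU⟩ := Metric.isOpen_iff.1 hU z hz
    exact ((hμ z r hr).1.trans_le (measure_mono hrU)).ne'⟩
  refine ⟨fun V _ _ _ _ => ⟨fun h => ?_, fun h => ?_⟩, fun h => ?_⟩
  · obtain ⟨C, hC⟩ := exists_uniform_aelipschitzWith h.ge
    exact hajlaszSpace_subset_sobolevSpace.antisymm (sobolevSpace_subset_of_real_bound hC)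
  · exact hajlaszSpace_subset_sobolevSpace.antisymm (sobolevSpace_real_subset h.ge)
  · obtain ⟨C, hC⟩ := exists_uniform_aelipschitzWith h.ge
    refine ⟨C + 1, by positivity, fun V _ _ _ =>
      ⟨hajlaszSpace_subset_sobolevSpace.antisymm (sobolevSpace_subset_of_real_bound hC),
        fun u _ => ⟨?_, hajlaszNorm_le_of_real_bound hC u⟩⟩⟩
    -- The lower bound already holds with `1/2`, so the factor `1/4` follows from `2 ≤ 4`.
    rw [one_div, mul_comm, ← div_eq_mul_inv]
    refine ENNReal.div_le_of_le_mul ((sobolevNorm_le_two_mul_hajlaszNorm u).trans ?_)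
    rw [mul_comm]
    gcongr
    norm_num
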